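/- Let $n_z,n_p,r\ge 0$ be integers with $r>0$ and $n_z>n_p+r$. Identify the Hurwitz space $\mathscr{H}^\omega_{0,n_z}(n_z-(n_p+r)-1,\,r-1,\,0,\dots,0)$ (with $n_p$ zeros at the end) with the open set of those $(a,b)\in\mathbb{C}^{n_z+n_p}$ for which, in $$\lambda(w)=\frac{1}{w^r}\,\frac{w^{n_z}+a_{n_z-1}w^{n_z-1}+\dots+a_0}{w^{n_p}+b_{n_p-1}w^{n_p-1}+\dots+b_0},$$ the two polynomials are coprime, neither vanishes at $0$, and the one in the denominator has pairwise distinct roots. Its primary differential is $\omega=-\frac{dw}{w}$, and its intersection form is $$g(V,W)=\sum_{x:\ d\lambda(x)=0}\operatorname{Res}_{x}\frac{V(\log\lambda)\,W(\log\lambda)}{d\log\lambda}\,\omega^2 ,$$ where the tangent vectors $V,W$ act on $\log\lambda$ at fixed $w$ and the sum is over the critical points of $\lambda$ (which are not poles). On the open subset where the zeros of $\lambda$ are pairwise distinct, the following hold. (i) $g$ is a well-defined non-degenerate symmetric complex bilinear form on each tangent space. (ii) Every point admits $\varphi_1,\dots,\varphi_{n_z},\psi_1,\dots,\psi_{n_p}\in\mathbb{C}$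 with $$\lambda(w)=\frac{1}{w^r}\,\frac{(w-e^{\varphi_1})\cdots(w-e^{\varphi_{n_z}})}{(w-e^{\psi_1})\cdots(w-e^{\psi_{n_p}})},$$ and every such choice at a point extends to a local holomorphic coordinate system $(\varphi,\psi)$ near that point satisfying this identity. (iii) All coordinate systems $(\varphi,\psi)$ of this kind are flat for $g$: the matrix of $g$ in the coordinate vector fields $\partial_{\varphi_i},\partial_{\psi_j}$ is constant, and it is one and the same invertible symmetric matrix for all of them. -/

import Mathlib

open Polynomial Filter Topology

noncomputable section

namespace TrigHurwitz

/-- Coefficient space `ℂ^{n_z + n_p}`: a point `c` collects the coefficients `a_i = c (inl i)` of the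
numerator and `b_j = c (inr j)` of the denominator (the two leading coefficients being `1`).
The logarithmic coordinates `(φ, ψ)` live in a space of the same shape. -/
abbrev Space (nz np : ℕ) : Type := Fin nz ⊕ Fin np → ℂ

/-- The numerator `w^{n_z} + a_{n_z-1} w^{n_z-1} + ... + a_0`. -/
def numer {nz np : ℕ} (c : Space nz np) : ℂ[X] :=
  X ^ nz + ∑ i : Fin nz, C (c (Sum.inl i)) * X ^ (i : ℕ)

/-- The denominator `w^{n_p} + b_{n_p-1} w^{n_p-1} + ... + b_0` (without the factor `w^r`). -/
def denom {nz np : ℕ} (c : Space nz np) : ℂ[X] :=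
  X ^ np + ∑ j : Fin np, C (c (Sum.inr j)) * X ^ (j : ℕ)

/-- The superpotential `λ(w) = w^{-r} numer(w) / denom(w)`. -/
def superpotential {nz np : ℕ} (r : ℕ) (c : Space nz np) (w : ℂ) : ℂ :=
  (numer c).eval w / (w ^ r * (denom c).eval w)

/-- The Hurwitz space `H_{0,n_z}(n_z - (n_p + r) - 1, r - 1, 0, ..., 0)`, in terms of the normalised
representatives `λ`: the point `w = 0` is a pole of order exactly `r`, there are `n_p` further
finite poles, all simple, and numerator and denominator have no common zero. -/
def hurwitzSpace (nz np : ℕ) : Set (Space nz np) :=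
  {c | (numer c).eval 0 ≠ 0 ∧ (denom c).eval 0 ≠ 0 ∧ (denom c).roots.Nodup ∧
    IsCoprime (numer c) (denom c)}

/-- The part of the Hurwitz space where no two zeros of `λ` coincide. -/
def distinctZeros (nz np : ℕ) : Set (Space nz np) :=
  {c | c ∈ hurwitzSpace nz np ∧ (numer c).roots.Nodup}

/-- Residue at `x` of the differential `f(w) dw` (for `f` with an isolated singularity at `x`):
the integral over a small circle around `x`, divided by `2πi`. -/
def residue (f : ℂ → ℂ) (x : ℂ) : ℂ :=
  limUnder (𝓝[>] (0 : ℝ)) fun ε : ℝ =>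
    (2 * (Real.pi : ℂ) * Complex.I)⁻¹ * ∮ w in C(x, ε), f w

/-- The set `Γ_λ` of critical points of `λ` (poles are excluded). -/
def criticalPoints {nz np : ℕ} (r : ℕ) (c : Space nz np) : Set ℂ :=
  {w | w ≠ 0 ∧ (denom c).eval w ≠ 0 ∧ deriv (superpotential r c) w = 0}

/-- `V (log λ)` at the point `c`, as a function of `w`: the derivative of `log λ` in the direction of
the tangent vector `V`, the coordinate `w` being kept fixed. -/
def dirLogDeriv {nz np : ℕ} (r : ℕ) (c V : Space nz np) (w : ℂ) : ℂ :=
  fderiv ℂ (fun c' : Space nz np => superpotential r c' w) c V / superpotential r c w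

/-- The density of the primary differential `ω = -dw / w`. -/
def primaryDensity (w : ℂ) : ℂ := -1 / w

/-- The intersection form of the Hurwitz space with primary differential `ω`:
`g(V, W) = ∑_{x ∈ Γ_λ} Res_x  V(log λ) W(log λ) / d(log λ) ω²`. -/
def intersectionForm {nz np : ℕ} (r : ℕ) (c V W : Space nz np) : ℂ :=
  ∑ᶠ x ∈ criticalPoints r c,
    residue (fun w => dirLogDeriv r c V w * dirLogDeriv r c W w /
      logDeriv (superpotential r c) w * primaryDensity w ^ 2) x

/-- `(φ, ψ) = (x ∘ inl, x ∘ inr)` are logarithms of the zeros and of the non-zero finite poles of `λ`: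
`λ(w) = w^{-r} ∏ (w - e^{φ_i}) / ∏ (w - e^{ψ_j})`.
(For `r > 0` both sides take the value `0` at the poles.) -/
def IsLogFactorisation {nz np : ℕ} (r : ℕ) (c x : Space nz np) : Prop :=
  ∀ w : ℂ, superpotential r c w =
    1 / w ^ r * ((∏ i : Fin nz, (w - Complex.exp (x (Sum.inl i)))) /
      ∏ j : Fin np, (w - Complex.exp (x (Sum.inr j))))

/-- A local holomorphic coordinate system on the locus of distinct zeros whose coordinate functions
are logarithms `φ_i` of the zeros and `ψ_j` of the poles of `λ`. -/
structure IsLogChart {nz np : ℕ} (r : ℕ)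
    (e : OpenPartialHomeomorph (Space nz np) (Space nz np)) : Prop where
  source_subset : e.source ⊆ distinctZeros nz np
  holomorphic : DifferentiableOn ℂ e e.source
  holomorphic_symm : DifferentiableOn ℂ e.symm e.target
  factorises : ∀ c ∈ e.source, IsLogFactorisation r c (e c)

/-- The coordinate vector field `∂/∂x_k` of the chart `e`, at the point `c`. -/
def coordField {nz np : ℕ} (e : OpenPartialHomeomorph (Space nz np) (Space nz np))
    (k : Fin nz ⊕ Fin np) (c : Space nz np) : Space nz np :=
  fderiv ℂ e.symm (e c) (Pi.single k 1)

end TrigHurwitz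

end

/-! Write `ζ_k` for the exponentials of all the logarithms and `s_k = -1` at zeros, `+1` at poles of
`λ`. A tangent vector `ξ` in logarithmic coordinates gives `ξ(log λ) = ∑ s_k ξ_k ζ_k / (w - ζ_k)`,
and `d log λ / dw = -∑ s_k / (w - ζ_k) - r / w`. With `Q = ∏ (w - ζ_k)` these are `N_ξ / Q`
(`fieldNumer`) and `P / (w Q)` (`critPoly`), so the integrand of `g` is `N_ξ N_η / (w Q P)`. The
roots of `P` are exactly the critical points (`criticalPoints_ofLogs`).

The leading coefficient of `P` is `n_z - n_p - r ≠ 0`, so there is no pole at infinity, and the sum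
over critical points is minus the sum of the residues at `0` and at the `ζ_k`. Those poles are
simple, and every dependence on `ζ` cancels (`sum_residue_critPoly`): `g(ξ, η) = ∑ s_k ξ_k η_k + r⁻¹
(∑ s_k ξ_k)(∑ s_k η_k)`. This diagonal plus rank-one form is non-degenerate because `r + ∑ s_k ≠ 0`.

Every logarithmic chart is a local inverse of the single map `ofLogs`, which is locally
biholomorphic where the `ζ_k` are distinct. Hence the matrix is the same for all charts. -/

noncomputable section

namespace TrigHurwitz

/-! ### Residues as integrals over small circles -/

/-- `f` has residue `ρ` at `x`: `f` is integrable over all sufficiently small circles around `x`,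
with integral `2πi ρ`. -/
def HasResidue (f : ℂ → ℂ) (x ρ : ℂ) : Prop :=
  ∀ᶠ ε : ℝ in 𝓝[>] 0, CircleIntegrable f x ε ∧
    (2 * (Real.pi : ℂ) * Complex.I)⁻¹ * ∮ w in C(x, ε), f w = ρ

theorem HasResidue.residue_eq {f : ℂ → ℂ} {x ρ : ℂ} (h : HasResidue f x ρ) : residue f x = ρ :=
  (tendsto_const_nhds.congr' (h.mono fun _ hε => hε.2.symm)).limUnder_eq

theorem HasResidue.congr {f g : ℂ → ℂ} {x ρ : ℂ} (h : HasResidue f x ρ) (hfg : f =ᶠ[𝓝[≠] x] g) :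
    HasResidue g x ρ := by
  obtain ⟨δ, hδ, hball⟩ := Metric.mem_nhdsWithin_iff.1 hfg
  filter_upwards [h, Ioo_mem_nhdsGT hδ] with ε hε hεδ
  have hs : Set.EqOn f g (Metric.sphere x ε) := fun w hw => hball
    ⟨by rw [Metric.mem_ball, Metric.mem_sphere.1 hw]; exact hεδ.2,
      Metric.ne_of_mem_sphere hw hεδ.1.ne'⟩
  refine ⟨hε.1.congr_codiscreteWithin ?_, ?_⟩
  · filter_upwards [self_mem_codiscreteWithin _] with w hw
    rw [abs_of_pos hεδ.1] at hw
    exact hs hw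
  · rw [← circleIntegral.integral_congr hεδ.1.le hs, hε.2]

/-- Additivity of circle integrals needs integrability, which is why `HasResidue` records it. -/
theorem HasResidue.add {f g : ℂ → ℂ} {x ρ σ : ℂ} (hf : HasResidue f x ρ) (hg : HasResidue g x σ) :
    HasResidue (fun w => f w + g w) x (ρ + σ) := by
  filter_upwards [hf, hg] with ε hf hg
  refine ⟨hf.1.add hg.1, ?_⟩
  rw [circleIntegral.integral_add hf.1 hg.1, mul_add, hf.2, hg.2]

theorem _root_.AnalyticAt.hasResidue_div {g : ℂ → ℂ} {x : ℂ} (hg : AnalyticAt ℂ g x) :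
    HasResidue (fun w => g w / (w - x)) x (g x) := by
  obtain ⟨δ, hδ, hball⟩ := Metric.eventually_nhds_iff_ball.1 hg.eventually_analyticAt
  filter_upwards [Ioo_mem_nhdsGT hδ] with ε hε
  have hd : DifferentiableOn ℂ g (Metric.closedBall x ε) := fun w hw =>
    (hball w (Metric.closedBall_subset_ball hε.2 hw)).differentiableAt.differentiableWithinAt
  constructor
  · refine ContinuousOn.circleIntegrable hε.1.le ?_
    refine (hd.continuousOn.mono Metric.sphere_subset_closedBall).div (by fun_prop) fun w hw => ?_
    exact sub_ne_zero.2 (Metric.ne_of_mem_sphere hw hε.1.ne')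
  · have := hd.circleIntegral_sub_inv_smul (Metric.mem_ball_self hε.1)
    simp only [smul_eq_mul, inv_mul_eq_div] at this
    rw [this, inv_mul_cancel_left₀ Complex.two_pi_I_ne_zero]

theorem _root_.AnalyticAt.hasResidue {g : ℂ → ℂ} {x : ℂ} (hg : AnalyticAt ℂ g x) :
    HasResidue g x 0 := by
  have h : AnalyticAt ℂ (fun w => (w - x) * g w) x := by fun_prop
  have := h.hasResidue_div
  simp only [sub_self, zero_mul] at this
  refine this.congr ?_
  filter_upwards [self_mem_nhdsWithin] with w hw
  exact mul_div_cancel_left₀ _ (sub_ne_zero.2 hw)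

theorem HasResidue.sum {ι : Type*} {s : Finset ι} {f : ι → ℂ → ℂ} {x : ℂ} {ρ : ι → ℂ}
    (h : ∀ i ∈ s, HasResidue (f i) x (ρ i)) :
    HasResidue (fun w => ∑ i ∈ s, f i w) x (∑ i ∈ s, ρ i) := by
  classical
  induction s using Finset.induction_on with
  | empty => simpa using (analyticAt_const : AnalyticAt ℂ (fun _ => (0 : ℂ)) x).hasResidue
  | insert i s hi ih =>
    simp only [Finset.sum_insert hi]
    exact (h i (Finset.mem_insert_self i s)).add
      (ih fun j hj => h j (Finset.mem_insert_of_mem hj))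

theorem hasResidue_div_sub_pow (c a x : ℂ) (m : ℕ) :
    HasResidue (fun w => c / (w - a) ^ (m + 1)) x (if a = x ∧ m = 0 then c else 0) := by
  by_cases hax : a = x
  · subst hax
    obtain rfl | hm := eq_or_ne m 0
    · simpa using (analyticAt_const : AnalyticAt ℂ (fun _ => c) a).hasResidue_div
    · rw [if_neg (by simp [hm])]
      filter_upwards [self_mem_nhdsWithin] with ε hε
      constructor
      · refine ContinuousOn.circleIntegrable (le_of_lt hε) ?_
        refine continuousOn_const.div (by fun_prop) fun w hw => ?_
        exact pow_ne_zero _ (sub_ne_zero.2 (Metric.ne_of_mem_sphere hw (ne_of_gt hε)))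
      -- The exponent differs from `-1`, so the integrand has a primitive off the centre.
      · have h := circleIntegral.integral_sub_zpow_of_ne (n := -((m : ℤ) + 1)) (by omega) a a ε
        have h2 : (fun w : ℂ => c / (w - a) ^ (m + 1)) =
            fun w => c * (w - a) ^ (-((m : ℤ) + 1)) := by
          ext w
          rw [zpow_neg, div_eq_mul_inv]
          norm_cast
        rw [h2, circleIntegral.integral_const_mul, h, mul_zero, mul_zero]
  · rw [if_neg (by simp [hax])]
    refine AnalyticAt.hasResidue ?_
    exact analyticAt_const.div (by fun_prop) (pow_ne_zero _ (sub_ne_zero.2 (Ne.symm hax)))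

/-! ### Partial fractions and the residue theorem on the sphere -/

/-- Partial fractions over `ℂ`, for a fraction `A / ∏ (w - a) ^ (n a)` whose numerator has degree
at most that of the denominator minus two. The coefficients of the simple fractions `1 / (w - a)`
add up to zero. -/
theorem exists_partialFractions_prod {A : ℂ[X]} (s : Finset ℂ) (n : ℂ → ℕ)
    (hA : A.degree + 2 ≤ (∏ a ∈ s, (X - C a) ^ n a).degree) :
    ∃ (c : (a : ℂ) → Fin (n a) → ℂ),
      (∀ w, (∏ a ∈ s, (X - C a) ^ n a).eval w ≠ 0 →
        A.eval w / (∏ a ∈ s, (X - C a) ^ n a).eval w =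
          ∑ a ∈ s, ∑ j, c a j / (w - a) ^ ((j.rev : ℕ) + 1)) ∧
      ∑ a ∈ s, ∑ j, (if (j.rev : ℕ) = 0 then c a j else 0) = 0 := by
  classical
  obtain ⟨q, r, hr, hf⟩ := eq_quo_mul_prod_pow_add_sum_rem_mul_prod_pow (s := s)
    A (g := fun a => X - C a) (fun a _ => monic_X_sub_C a)
    (fun a _ b _ hab => pairwise_coprime_X_sub_C Function.injective_id hab) n
  obtain ⟨D, hD⟩ : ∃ D, D = ∏ a ∈ s, (X - C a) ^ n a := ⟨_, rfl⟩
  obtain ⟨c, hc⟩ : ∃ c : (a : ℂ) → Fin (n a) → ℂ, ∀ a j, c a j = (r a j).coeff 0 :=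
    ⟨_, fun _ _ => rfl⟩
  obtain ⟨T, hT⟩ : ∃ T : (a : ℂ) → Fin (n a) → ℂ[X], ∀ a j, T a j =
    (X - C a) ^ (j : ℕ) * ∏ k ∈ s.erase a, (X - C k) ^ n k := ⟨_, fun _ _ => rfl⟩
  have hDm : D.Monic := by
    rw [hD]; exact monic_prod_of_monic _ _ fun a _ => (monic_X_sub_C a).pow _
  have hrc : ∀ a ∈ s, ∀ j, r a j = C (c a j) := fun a ha j => by
    rw [hc]
    refine eq_C_of_degree_le_zero (Nat.WithBot.lt_one_iff_le_zero.1 ?_)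
    rw [← degree_X_sub_C a]
    exact hr a ha j
  have hTm : ∀ a j, (T a j).Monic := fun a j => by
    rw [hT]
    exact ((monic_X_sub_C a).pow _).mul (monic_prod_of_monic _ _ fun a _ =>
      (monic_X_sub_C a).pow _)
  -- `T a j` retains `(X - a) ^ j`, so dividing by `D` leaves a pole of order `n a - j`, which is
  -- `j.rev + 1`.
  have hTD : ∀ a ∈ s, ∀ j : Fin (n a), T a j * (X - C a) ^ ((j.rev : ℕ) + 1) = D :=
    fun a ha j => by
      have hj : (j : ℕ) + ((j.rev : ℕ) + 1) = n a := by rw [Fin.val_rev]; omega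
      rw [hD, hT, ← Finset.mul_prod_erase s _ ha, mul_right_comm, ← pow_add, hj]
  have hTdeg : ∀ a ∈ s, ∀ j : Fin (n a), (T a j).natDegree + ((j.rev : ℕ) + 1) = D.natDegree :=
    fun a ha j => by
      have h := congrArg natDegree (hTD a ha j)
      rw [(hTm a j).natDegree_mul ((monic_X_sub_C a).pow _), natDegree_pow, natDegree_X_sub_C,
        mul_one] at h
      exact h
  have hf' : A = q * D + ∑ a ∈ s, ∑ j, C (c a j) * T a j := by
    rw [hD]
    refine hf.trans (congrArg (q * _ + ·) ?_)
    refine Finset.sum_congr rfl fun a ha => Finset.sum_congr rfl fun j _ => ?_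
    rw [hrc a ha j, hT, mul_assoc]
  rw [← hD] at hA ⊢
  have hlt1 : A.degree < (D.natDegree - 1 : ℕ) := by
    by_cases h0 : A = 0
    · rw [h0, degree_zero]; exact WithBot.bot_lt_coe _
    · rw [degree_eq_natDegree h0, degree_eq_natDegree hDm.ne_zero] at hA
      rw [degree_eq_natDegree h0]
      norm_cast at hA ⊢
      omega
  -- All the other terms have degree below that of `D`, so the multiple `q * D` must vanish.
  have hq : q = 0 := by
    have hlt : (A - ∑ a ∈ s, ∑ j, C (c a j) * T a j).degree < D.degree := by
      have hb : ⊥ < D.degree := bot_lt_iff_ne_bot.2 (degree_ne_bot.2 hDm.ne_zero)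
      refine (degree_sub_le _ _).trans_lt (max_lt ?_ ?_)
      · refine hlt1.trans_le ?_
        rw [degree_eq_natDegree hDm.ne_zero]
        exact_mod_cast Nat.sub_le _ _
      · refine (degree_sum_le _ _).trans_lt ((Finset.sup_lt_iff hb).2 fun a ha => ?_)
        refine (degree_sum_le _ _).trans_lt ((Finset.sup_lt_iff hb).2 fun j _ => ?_)
        have := hTdeg a ha j
        exact degree_lt_degree ((natDegree_C_mul_le _ _).trans_lt (by omega))
    have h1 : A - ∑ a ∈ s, ∑ j, C (c a j) * T a j = q * D := sub_eq_of_eq_add hf'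
    have h0 := eq_zero_of_dvd_of_degree_lt ⟨q, h1.trans (mul_comm _ _)⟩ hlt
    rw [h1] at h0
    exact (mul_eq_zero.1 h0).resolve_right hDm.ne_zero
  rw [hq, zero_mul, zero_add] at hf'
  refine ⟨c, fun w hw => ?_, ?_⟩
  · rw [hf', eval_finsetSum, Finset.sum_div]
    refine Finset.sum_congr rfl fun a ha => ?_
    rw [eval_finsetSum, Finset.sum_div]
    refine Finset.sum_congr rfl fun j _ => ?_
    have hT := congrArg (eval w) (hTD a ha j)
    rw [eval_mul, eval_pow, eval_sub, eval_X, eval_C] at hT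
    have h2 : (T a j).eval w ≠ 0 := fun h => hw (by rw [← hT, h, zero_mul])
    rw [eval_mul, eval_C, ← hT, mul_comm (c a j), mul_div_mul_left _ _ h2]
  -- Compare coefficients in degree `deg D - 1`: it vanishes for `A`, and among the monic `T a j`
  -- only those of simple fractions reach this degree.
  · have h := congrArg (fun p => coeff p (D.natDegree - 1)) hf'
    simp only [finsetSum_coeff, coeff_C_mul] at h
    rw [coeff_eq_zero_of_degree_lt hlt1] at h
    refine (Finset.sum_congr rfl fun a ha => Finset.sum_congr rfl fun j _ => ?_).trans h.symm
    have hd := hTdeg a ha j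
    split_ifs with hj
    · have : D.natDegree - 1 = (T a j).natDegree := by omega
      rw [this, coeff_natDegree, (hTm a j).leadingCoeff, mul_one]
    · rw [coeff_eq_zero_of_natDegree_lt (by omega), mul_zero]

/-- Partial fractions over `ℂ`, for a fraction `A / B` with `deg A + 2 ≤ deg B`. The coefficients
of the simple fractions `1 / (w - a)` add up to zero. -/
theorem exists_partialFractions {A B : ℂ[X]} (hAB : A.degree + 2 ≤ B.degree) (hB : B ≠ 0) :
    ∃ (c : (a : ℂ) → Fin (B.rootMultiplicity a) → ℂ),
      (∀ w, B.eval w ≠ 0 → A.eval w / B.eval w =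
        ∑ a ∈ B.roots.toFinset, ∑ j, c a j / (w - a) ^ ((j.rev : ℕ) + 1)) ∧
      ∑ a ∈ B.roots.toFinset, ∑ j, (if (j.rev : ℕ) = 0 then c a j else 0) = 0 := by
  classical
  have hlc : B.leadingCoeff ≠ 0 := leadingCoeff_ne_zero.2 hB
  have hprod : B = C B.leadingCoeff *
      ∏ a ∈ B.roots.toFinset, (X - C a) ^ B.rootMultiplicity a := by
    have h := (IsAlgClosed.splits B).eq_prod_roots
    rw [Finset.prod_multiset_map_count] at h
    simpa only [count_roots] using h
  have hdeg := congrArg degree hprod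
  rw [degree_C_mul hlc] at hdeg
  obtain ⟨c, hc, h0⟩ := exists_partialFractions_prod (A := C B.leadingCoeff⁻¹ * A)
    B.roots.toFinset (fun a => B.rootMultiplicity a)
    (by rw [degree_C_mul (inv_ne_zero hlc), ← hdeg]; exact hAB)
  refine ⟨c, fun w hw => ?_, h0⟩
  have hev := congrArg (eval w) hprod
  rw [eval_mul, eval_C] at hev
  rw [← hc w fun h => hw (by rw [hev, h, mul_zero]), hev, eval_mul, eval_C,
    inv_mul_eq_div, div_div]

/-- The residues of a rational differential without a pole at infinity add up to zero. -/
theorem sum_residue_eq_zero {A B : ℂ[X]} (hAB : A.degree + 2 ≤ B.degree) (hB : B ≠ 0) :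
    ∑ a ∈ B.roots.toFinset, residue (fun w => A.eval w / B.eval w) a = 0 := by
  classical
  obtain ⟨c, hc, h0⟩ := exists_partialFractions hAB hB
  rw [← h0]
  refine Finset.sum_congr rfl fun x hx => HasResidue.residue_eq ?_
  have hres : HasResidue (fun w => ∑ a ∈ B.roots.toFinset, ∑ j, c a j / (w - a) ^ ((j.rev : ℕ) + 1))
      x (∑ a ∈ B.roots.toFinset, ∑ j : Fin (B.rootMultiplicity a),
        if a = x ∧ (j.rev : ℕ) = 0 then c a j else 0) :=
    HasResidue.sum fun a _ => HasResidue.sum fun j _ => hasResidue_div_sub_pow _ _ _ _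
  rw [Finset.sum_eq_single_of_mem x hx
    fun a _ ha => Finset.sum_eq_zero fun j _ => if_neg fun h => ha h.1] at hres
  simp only [true_and] at hres
  refine hres.congr ?_
  have hfin : ∀ᶠ w in 𝓝[≠] x, w ∉ B.roots.toFinset :=
    nhdsNE_le_cofinite x (Finset.finite_toSet _).compl_mem_cofinite
  filter_upwards [hfin] with w hw
  exact (hc w fun h => hw (by simp [hB, h])).symm

/-- The residue at a simple zero of the denominator. -/
theorem residue_div_mul {A B : ℂ[X]} {x : ℂ} (hB : B.eval x ≠ 0) :
    residue (fun w => A.eval w / ((X - C x) * B).eval w) x = A.eval x / B.eval x := by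
  have h : AnalyticAt ℂ (fun w => A.eval w / B.eval w) x := by
    refine AnalyticAt.div ?_ ?_ hB
    · exact (A.differentiable.analyticAt x)
    · exact (B.differentiable.analyticAt x)
  refine HasResidue.residue_eq (h.hasResidue_div.congr (Eventually.of_forall fun w => ?_))
  simp only [eval_mul, eval_sub, eval_X, eval_C]
  rw [div_div, mul_comm]

/-- Small circles avoid the centre, so both limits are of eventually equal functions; no existence
of the residue is required. -/
theorem residue_congr {f g : ℂ → ℂ} {x : ℂ} (hfg : f =ᶠ[𝓝[≠] x] g) : residue f x = residue g x := by
  obtain ⟨δ, hδ, hball⟩ := Metric.mem_nhdsWithin_iff.1 hfg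
  have h : (fun ε : ℝ => (2 * (Real.pi : ℂ) * Complex.I)⁻¹ * ∮ w in C(x, ε), f w)
      =ᶠ[𝓝[>] 0] fun ε : ℝ => (2 * (Real.pi : ℂ) * Complex.I)⁻¹ * ∮ w in C(x, ε), g w := by
    filter_upwards [Ioo_mem_nhdsGT hδ] with ε hε
    rw [circleIntegral.integral_congr hε.1.le fun w hw => hball
      ⟨by rw [Metric.mem_ball, Metric.mem_sphere.1 hw]; exact hε.2,
        Metric.ne_of_mem_sphere hw hε.1.ne'⟩]
  rw [residue, residue, limUnder, limUnder, Filter.map_congr h]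

/-! ### The residue sum as a constant bilinear form -/

/-- The constant matrix of the intersection form in logarithmic coordinates. -/
def formMatrix {ι : Type*} [DecidableEq ι] (r : ℂ) (s : ι → ℂ) : Matrix ι ι ℂ :=
  Matrix.diagonal s + Matrix.of fun k l => r⁻¹ * (s k * s l)

theorem formMatrix_isSymm {ι : Type*} [DecidableEq ι] (r : ℂ) (s : ι → ℂ) :
    (formMatrix r s).IsSymm := by
  ext k l
  simp only [formMatrix, Matrix.transpose_apply, Matrix.add_apply, Matrix.of_apply,
    Matrix.diagonal_apply, mul_comm (s l), eq_comm (a := l)]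
  congr 1
  split_ifs with h
  · rw [h]
  · rfl

section RationalForm

variable {ι : Type*} [Fintype ι] [DecidableEq ι]

/-- The numerator of `∑ k, s k * ξ k * ζ k / (w - ζ k)` over the denominator `∏ k, (w - ζ k)`. -/
def fieldNumer (s ζ ξ : ι → ℂ) : ℂ[X] :=
  ∑ k, C (s k * ξ k * ζ k) * Lagrange.nodal (Finset.univ.erase k) ζ

/-- The numerator of `-∑ k, s k / (w - ζ k) - r / w` over the denominator `w * ∏ k, (w - ζ k)`. -/
def critPoly (r : ℂ) (s ζ : ι → ℂ) : ℂ[X] :=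
  -(∑ k, C (s k) * (X * Lagrange.nodal (Finset.univ.erase k) ζ)) -
    C r * Lagrange.nodal Finset.univ ζ

theorem nodal_univ_eq_mul_erase (ζ : ι → ℂ) (k : ι) :
    Lagrange.nodal Finset.univ ζ = (X - C (ζ k)) * Lagrange.nodal (Finset.univ.erase k) ζ :=
  Lagrange.nodal_eq_mul_nodal_erase (Finset.mem_univ k)

theorem eval_nodal_erase_ne_zero {ζ : ι → ℂ} (hζ : Function.Injective ζ) (k : ι) :
    (Lagrange.nodal (Finset.univ.erase k) ζ).eval (ζ k) ≠ 0 :=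
  Lagrange.eval_nodal_not_at_node fun _ hi h => Finset.ne_of_mem_erase hi (hζ h.symm)

theorem eval_nodal_erase_of_ne (ζ : ι → ℂ) {k l : ι} (h : l ≠ k) :
    (Lagrange.nodal (Finset.univ.erase l) ζ).eval (ζ k) = 0 :=
  Lagrange.eval_nodal_at_node (Finset.mem_erase.2 ⟨h.symm, Finset.mem_univ k⟩)

theorem eval_fieldNumer_node (s ζ ξ : ι → ℂ) (k : ι) :
    (fieldNumer s ζ ξ).eval (ζ k) =
      s k * ξ k * ζ k * (Lagrange.nodal (Finset.univ.erase k) ζ).eval (ζ k) := by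
  rw [fieldNumer, eval_finsetSum, Finset.sum_eq_single k]
  · simp
  · intro l _ hl
    rw [eval_mul, eval_nodal_erase_of_ne ζ hl, mul_zero]
  · simp

theorem eval_fieldNumer {s ζ ξ : ι → ℂ} {w : ℂ} (hw : ∀ k, w ≠ ζ k) :
    (fieldNumer s ζ ξ).eval w =
      (∑ k, s k * ξ k * ζ k / (w - ζ k)) * (Lagrange.nodal Finset.univ ζ).eval w := by
  rw [fieldNumer, eval_finsetSum, Finset.sum_mul]
  refine Finset.sum_congr rfl fun k _ => ?_
  rw [nodal_univ_eq_mul_erase ζ k]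
  simp only [eval_mul, eval_C, eval_sub, eval_X]
  have := sub_ne_zero.2 (hw k)
  field_simp

/-- Only the `k`-th summand survives. The value is minus that of `fieldNumer` with `ξ k = 1`, which
makes the residue at `ζ k` independent of `ζ`. -/
theorem eval_critPoly_node (r : ℂ) (s ζ : ι → ℂ) (k : ι) :
    (critPoly r s ζ).eval (ζ k) =
      -(s k * ζ k * (Lagrange.nodal (Finset.univ.erase k) ζ).eval (ζ k)) := by
  rw [critPoly, eval_sub, eval_neg, eval_finsetSum, Finset.sum_eq_single k]
  · simp [Lagrange.eval_nodal_at_node (Finset.mem_univ k), mul_assoc]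
  · intro l _ hl
    rw [eval_mul, eval_mul, eval_nodal_erase_of_ne ζ hl, mul_zero, mul_zero]
  · simp

theorem eval_critPoly_zero (r : ℂ) (s ζ : ι → ℂ) :
    (critPoly r s ζ).eval 0 = -(r * (Lagrange.nodal Finset.univ ζ).eval 0) := by
  simp [critPoly, eval_finsetSum]

theorem eval_critPoly {r : ℂ} {s ζ : ι → ℂ} {w : ℂ} (h0 : w ≠ 0) (hw : ∀ k, w ≠ ζ k) :
    (critPoly r s ζ).eval w = (-(∑ k, s k / (w - ζ k)) - r / w) *
      (w * (Lagrange.nodal Finset.univ ζ).eval w) := by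
  rw [critPoly, eval_sub, eval_neg, eval_finsetSum, sub_mul, neg_mul, Finset.sum_mul]
  congr 2
  · refine Finset.sum_congr rfl fun k _ => ?_
    rw [nodal_univ_eq_mul_erase ζ k]
    simp only [eval_mul, eval_C, eval_sub, eval_X]
    have := sub_ne_zero.2 (hw k)
    field_simp
  · simp only [eval_mul, eval_C]
    field_simp

theorem degree_fieldNumer_lt (s ζ ξ : ι → ℂ) :
    (fieldNumer s ζ ξ).degree < (Fintype.card ι : WithBot ℕ) := by
  refine (degree_sum_le _ _).trans_lt ((Finset.sup_lt_iff (WithBot.bot_lt_coe _)).2 fun k hk => ?_)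
  rw [← smul_eq_C_mul]
  refine (degree_smul_le _ _).trans_lt ?_
  rw [Lagrange.degree_nodal, Finset.card_erase_of_mem hk, Finset.card_univ]
  exact_mod_cast Nat.sub_lt (Fintype.card_pos_iff.2 ⟨k⟩) one_pos

/-- This coefficient governs the behaviour at infinity; its non-vanishing bounds the degree from
below. -/
theorem coeff_critPoly (r : ℂ) (s ζ : ι → ℂ) :
    (critPoly r s ζ).coeff (Fintype.card ι) = -(∑ k, s k) - r := by
  rw [critPoly, coeff_sub, coeff_neg, finsetSum_coeff, coeff_C_mul]
  congr 2
  · refine Finset.sum_congr rfl fun k hk => ?_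
    have hcard : Fintype.card ι = (Finset.univ.erase k).card + 1 := by
      rw [Finset.card_erase_add_one hk, Finset.card_univ]
    rw [coeff_C_mul, hcard, coeff_X_mul, ← Lagrange.natDegree_nodal (v := ζ), coeff_natDegree,
      Lagrange.nodal_monic.leadingCoeff, mul_one]
  · rw [← Finset.card_univ, ← Lagrange.natDegree_nodal (v := ζ), coeff_natDegree,
      Lagrange.nodal_monic.leadingCoeff, mul_one]

variable {r : ℂ} {s ζ : ι → ℂ}

theorem le_degree_critPoly (hsr : r + ∑ k, s k ≠ 0) :
    (Fintype.card ι : WithBot ℕ) ≤ (critPoly r s ζ).degree := by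
  refine le_degree_of_ne_zero ?_
  rw [coeff_critPoly]
  intro h
  exact hsr (by linear_combination -h)

theorem critPoly_ne_zero (hsr : r + ∑ k, s k ≠ 0) : critPoly r s ζ ≠ 0 := fun h => by
  have := le_degree_critPoly (ζ := ζ) hsr
  simp [h] at this

/-- With `n` nodes, each factor above has degree at most `n - 1` while the denominator has degree at
least `2n + 1`: the differential is regular at infinity. -/
theorem degree_fieldNumer_mul_add_two_le (hsr : r + ∑ k, s k ≠ 0) (ξ η : ι → ℂ) :
    (fieldNumer s ζ ξ * fieldNumer s ζ η).degree + 2 ≤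
      (X * Lagrange.nodal Finset.univ ζ * critPoly r s ζ).degree := by
  rw [degree_mul, degree_mul, degree_mul, Lagrange.degree_nodal, degree_X, Finset.card_univ]
  refine le_trans ?_ (add_le_add_right (le_degree_critPoly hsr) _)
  have h1 := degree_fieldNumer_lt s ζ ξ
  have h2 := degree_fieldNumer_lt s ζ η
  generalize (fieldNumer s ζ ξ).degree = a at h1 ⊢
  generalize (fieldNumer s ζ η).degree = b at h2 ⊢
  -- A numerator may be zero, of degree `⊥`; otherwise the bound is arithmetic in `ℕ`.
  induction a with
  | bot => simp
  | coe a =>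
    induction b with
    | bot => simp
    | coe b =>
      rw [← Nat.cast_withBot] at h1 h2 ⊢
      rw [← Nat.cast_withBot]
      norm_cast at h1 h2 ⊢
      omega

/-- The sum over the zeros of `critPoly` of the residues of the integrand of the intersection form,
computed from the residues at the other poles. -/
theorem sum_residue_critPoly (hr : r ≠ 0) (hs : ∀ k, s k ≠ 0) (hζ : Function.Injective ζ)
    (hζ0 : ∀ k, ζ k ≠ 0) (hsr : r + ∑ k, s k ≠ 0) (ξ η : ι → ℂ) :
    ∑ x ∈ (critPoly r s ζ).roots.toFinset,
        residue (fun w => (fieldNumer s ζ ξ * fieldNumer s ζ η).eval w /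
          (X * Lagrange.nodal Finset.univ ζ * critPoly r s ζ).eval w) x =
      ∑ k, s k * ξ k * η k + r⁻¹ * (∑ k, s k * ξ k) * ∑ k, s k * η k := by
  have hQ0 : (Lagrange.nodal Finset.univ ζ).eval 0 ≠ 0 :=
    Lagrange.eval_nodal_not_at_node fun k _ => (hζ0 k).symm
  have hP := critPoly_ne_zero (ζ := ζ) hsr
  have hP0 : (critPoly r s ζ).eval 0 ≠ 0 := by
    rw [eval_critPoly_zero]; exact neg_ne_zero.2 (mul_ne_zero hr hQ0)
  have hPζ : ∀ k, (critPoly r s ζ).eval (ζ k) ≠ 0 := fun k => by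
    rw [eval_critPoly_node]
    exact neg_ne_zero.2 (mul_ne_zero (mul_ne_zero (hs k) (hζ0 k)) (eval_nodal_erase_ne_zero hζ k))
  have hQ : Lagrange.nodal Finset.univ ζ ≠ 0 := Lagrange.nodal_ne_zero
  have hB : X * Lagrange.nodal Finset.univ ζ * critPoly r s ζ ≠ 0 :=
    mul_ne_zero (mul_ne_zero X_ne_zero hQ) hP
  have hroots : (X * Lagrange.nodal Finset.univ ζ * critPoly r s ζ).roots.toFinset =
      insert 0 (Finset.univ.image ζ ∪ (critPoly r s ζ).roots.toFinset) := by
    ext w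
    simp only [Multiset.mem_toFinset, mem_roots hB, mem_roots hP, Finset.mem_insert,
      Finset.mem_union, Finset.mem_image, Finset.mem_univ, true_and, IsRoot.def, eval_mul, eval_X,
      mul_eq_zero, Lagrange.eval_nodal, Finset.prod_eq_zero_iff, sub_eq_zero, or_assoc]
    simp only [eq_comm (a := w)]
  -- Multiple roots of `critPoly` are allowed here, so degenerate critical points need no separate
  -- treatment.
  have hsum := sum_residue_eq_zero (degree_fieldNumer_mul_add_two_le (ζ := ζ) hsr ξ η) hB
  rw [hroots, Finset.sum_insert, Finset.sum_union, Finset.sum_image hζ.injOn] at hsum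
  -- The pole at `0` contributes the rank-one term, since both numerators and `critPoly` are
  -- multiples of `Q(0)` there.
  · have hres0 : residue (fun w => (fieldNumer s ζ ξ * fieldNumer s ζ η).eval w /
        (X * Lagrange.nodal Finset.univ ζ * critPoly r s ζ).eval w) 0 =
        -(r⁻¹ * (∑ k, s k * ξ k) * ∑ k, s k * η k) := by
      have hA : ∀ ξ : ι → ℂ, (fieldNumer s ζ ξ).eval 0 =
          -(∑ k, s k * ξ k) * (Lagrange.nodal Finset.univ ζ).eval 0 := fun ξ => by
        rw [eval_fieldNumer fun k => (hζ0 k).symm, ← Finset.sum_neg_distrib]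
        congr 1
        refine Finset.sum_congr rfl fun k _ => ?_
        have := hζ0 k
        field_simp
        ring
      have h := residue_div_mul (A := fieldNumer s ζ ξ * fieldNumer s ζ η)
        (B := Lagrange.nodal Finset.univ ζ * critPoly r s ζ) (x := 0)
        (by rw [eval_mul]; exact mul_ne_zero hQ0 hP0)
      rw [C_0, sub_zero, ← mul_assoc] at h
      rw [h, eval_mul, eval_mul, hA, hA, eval_critPoly_zero]
      field_simp
    -- The poles at the nodes contribute the diagonal term.
    have hresζ : ∀ k, residue (fun w => (fieldNumer s ζ ξ * fieldNumer s ζ η).eval w /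
        (X * Lagrange.nodal Finset.univ ζ * critPoly r s ζ).eval w) (ζ k) =
        -(s k * ξ k * η k) := fun k => by
      have hQk := eval_nodal_erase_ne_zero hζ k
      have h := residue_div_mul (A := fieldNumer s ζ ξ * fieldNumer s ζ η)
        (B := X * Lagrange.nodal (Finset.univ.erase k) ζ * critPoly r s ζ) (x := ζ k)
        (by
          rw [eval_mul, eval_mul, eval_X]
          exact mul_ne_zero (mul_ne_zero (hζ0 k) hQk) (hPζ k))
      rw [← mul_assoc, mul_left_comm, ← nodal_univ_eq_mul_erase] at h
      rw [h, eval_mul, eval_mul, eval_mul, eval_X, eval_fieldNumer_node, eval_fieldNumer_node,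
        eval_critPoly_node]
      have := hs k
      have := hζ0 k
      field_simp
    rw [hres0, Finset.sum_congr rfl fun k _ => hresζ k, Finset.sum_neg_distrib] at hsum
    linear_combination hsum
  · rw [Finset.disjoint_left]
    intro w hw hw'
    obtain ⟨k, -, rfl⟩ := Finset.mem_image.1 hw
    exact hPζ k (by simpa [hP] using hw')
  · simp only [Finset.mem_union, Finset.mem_image, Finset.mem_univ, true_and, Multiset.mem_toFinset,
      mem_roots hP, not_or, not_exists]
    exact ⟨hζ0, hP0⟩

theorem formMatrix_toBilin'_apply (r : ℂ) (s ξ η : ι → ℂ) :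
    Matrix.toBilin' (formMatrix r s) ξ η =
      ∑ k, s k * ξ k * η k + r⁻¹ * (∑ k, s k * ξ k) * ∑ k, s k * η k := by
  rw [Matrix.toBilin'_apply, mul_assoc, Finset.sum_mul_sum, Finset.mul_sum, ← Finset.sum_add_distrib]
  refine Finset.sum_congr rfl fun k _ => ?_
  simp only [formMatrix, Matrix.add_apply, Matrix.of_apply, mul_add, add_mul, Finset.mul_sum,
    Finset.sum_add_distrib]
  congr 1
  · rw [Finset.sum_eq_single k]
    · rw [Matrix.diagonal_apply_eq]; ring
    · intro l _ hl
      rw [Matrix.diagonal_apply_ne _ hl.symm]; ring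
    · simp
  · exact Finset.sum_congr rfl fun l _ => by ring

/-- For `v` in the kernel, `r * v k = -S` for every `k`, with `S = ∑ s l * v l`. Weighting by `s k`
and summing gives `(r + ∑ s k) * S = 0`, hence `S = 0` and `v = 0`. -/
theorem formMatrix_det_ne_zero (hr : r ≠ 0) (hs : ∀ k, s k ≠ 0) (hsr : r + ∑ k, s k ≠ 0) :
    (formMatrix r s).det ≠ 0 := by
  intro h
  obtain ⟨v, hv, hv0⟩ := Matrix.exists_mulVec_eq_zero_iff.2 h
  have hk : ∀ k, r * v k = -∑ l, s l * v l := fun k => by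
    have h1 := congrFun hv0 k
    have h2 : (Matrix.of fun k l => r⁻¹ * (s k * s l)).mulVec v k =
        r⁻¹ * s k * ∑ l, s l * v l := by
      rw [Matrix.mulVec, dotProduct, Finset.mul_sum]
      exact Finset.sum_congr rfl fun l _ => by rw [Matrix.of_apply]; ring
    rw [formMatrix, Matrix.add_mulVec, Pi.add_apply, Matrix.mulVec_diagonal, h2,
      Pi.zero_apply] at h1
    have := hs k
    have h3 : s k * (r * v k + ∑ l, s l * v l) = 0 := by
      field_simp at h1
      linear_combination h1
    exact eq_neg_of_add_eq_zero_left ((mul_eq_zero.1 h3).resolve_left this)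
  have hS : (r + ∑ k, s k) * ∑ l, s l * v l = 0 := by
    have : r * ∑ l, s l * v l = ∑ l, s l * -∑ l, s l * v l := by
      rw [Finset.mul_sum]
      exact Finset.sum_congr rfl fun l _ => by rw [← hk l]; ring
    rw [← Finset.sum_mul] at this
    linear_combination this
  refine hv (funext fun k => ?_)
  have := hk k
  rw [(mul_eq_zero.1 hS).resolve_left hsr, neg_zero] at this
  exact (mul_eq_zero.1 this).resolve_left hr

end RationalForm

/-! ### Monic polynomials, their coefficients and roots -/

section Polynomials

theorem eq_X_pow_add_sum_of_monic {p : ℂ[X]} {n : ℕ} (hp : p.Monic) (hn : p.natDegree = n) :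
    X ^ n + ∑ i : Fin n, C (p.coeff i) * X ^ (i : ℕ) = p := by
  subst hn
  rw [← Finset.sum_range fun i => C (p.coeff i) * X ^ i]
  exact hp.as_sum.symm

theorem coeff_X_pow_add_sum {n : ℕ} (a : Fin n → ℂ) (i : Fin n) :
    (X ^ n + ∑ i : Fin n, C (a i) * X ^ (i : ℕ) : ℂ[X]).coeff i = a i := by
  rw [coeff_add, coeff_X_pow, if_neg i.isLt.ne, zero_add, finsetSum_coeff,
    Finset.sum_eq_single i]
  · simp
  · intro j _ hj
    rw [coeff_C_mul, coeff_X_pow, if_neg fun h => hj (Fin.ext h.symm), mul_zero]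
  · simp

theorem degree_sum_C_mul_X_pow_lt {n : ℕ} (a : Fin n → ℂ) :
    (∑ i : Fin n, C (a i) * X ^ (i : ℕ) : ℂ[X]).degree < n := by
  refine (degree_sum_le _ _).trans_lt ((Finset.sup_lt_iff (WithBot.bot_lt_coe _)).2 fun i _ => ?_)
  exact (degree_C_mul_X_pow_le _ _).trans_lt (by exact_mod_cast i.isLt)

theorem monic_X_pow_add_sum {n : ℕ} (a : Fin n → ℂ) :
    (X ^ n + ∑ i : Fin n, C (a i) * X ^ (i : ℕ) : ℂ[X]).Monic :=
  monic_X_pow_add (degree_sum_C_mul_X_pow_lt a)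

theorem natDegree_X_pow_add_sum {n : ℕ} (a : Fin n → ℂ) :
    (X ^ n + ∑ i : Fin n, C (a i) * X ^ (i : ℕ) : ℂ[X]).natDegree = n := by
  refine natDegree_eq_of_degree_eq_some ?_
  rw [degree_add_eq_left_of_degree_lt, degree_X_pow]
  rw [degree_X_pow]
  exact degree_sum_C_mul_X_pow_lt a

theorem roots_prod_X_sub_C_comp {ι : Type*} [Fintype ι] (f : ι → ℂ) :
    (∏ i, (X - C (f i))).roots = Finset.univ.val.map f := by
  rw [← roots_multiset_prod_X_sub_C (Finset.univ.val.map f), Multiset.map_map]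
  rfl

theorem nodup_roots_prod_X_sub_C_iff {ι : Type*} [Fintype ι] (f : ι → ℂ) :
    (∏ i, (X - C (f i))).roots.Nodup ↔ Function.Injective f := by
  rw [roots_prod_X_sub_C_comp, Multiset.nodup_map_iff_inj_on Finset.univ.nodup]
  simp [Function.Injective]

/-- A monic polynomial that does not vanish at `0` is a product of factors `X - exp (x i)`. -/
theorem exists_prod_X_sub_C_exp {p : ℂ[X]} {n : ℕ} (hp : p.Monic) (hn : p.natDegree = n)
    (h0 : p.eval 0 ≠ 0) : ∃ x : Fin n → ℂ, p = ∏ i, (X - C (Complex.exp (x i))) := by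
  have hcard : p.roots.toList.length = n := by
    rw [Multiset.length_toList, ← (IsAlgClosed.splits p).natDegree_eq_card_roots, hn]
  subst hcard
  refine ⟨fun i => Complex.log (p.roots.toList.get i), ?_⟩
  have hexp : ∀ i, Complex.exp (Complex.log (p.roots.toList.get i)) = p.roots.toList.get i :=
    fun i => Complex.exp_log fun h => h0 <| by
      have := List.get_mem p.roots.toList i
      rw [h, Multiset.mem_toList] at this
      exact (mem_roots'.1 this).2
  simp only [hexp]
  have h1 := (IsAlgClosed.splits p).eq_prod_roots
  rw [hp.leadingCoeff, C_1, one_mul] at h1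
  conv_lhs => rw [h1, ← Multiset.coe_toList p.roots]
  rw [Multiset.map_coe, Multiset.prod_coe, ← List.prod_ofFn]
  congr 1
  conv_lhs => rw [← List.ofFn_get p.roots.toList, List.map_ofFn]
  rfl

theorem contDiff_coeff_prod_X_sub_C {E ι : Type*} [NormedAddCommGroup E] [NormedSpace ℂ E]
    {m : WithTop ℕ∞} {s : Finset ι} {f : ι → E → ℂ} (hf : ∀ i ∈ s, ContDiff ℂ m (f i)) (k : ℕ) :
    ContDiff ℂ m fun x => (∏ i ∈ s, (X - C (f i x))).coeff k := by
  classical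
  induction s using Finset.induction_on generalizing k with
  | empty => simpa using contDiff_const
  | insert i s hi ih =>
    have h1 := hf i (Finset.mem_insert_self i s)
    have h2 := ih fun j hj => hf j (Finset.mem_insert_of_mem hj)
    simp only [Finset.prod_insert hi]
    cases k with
    | zero =>
      simp only [mul_coeff_zero, coeff_sub, coeff_X_zero, coeff_C_zero, zero_sub]
      exact h1.neg.mul (h2 0)
    | succ k =>
      simp only [coeff_X_sub_C_mul]
      exact (h2 k).sub (h1.mul (h2 (k + 1)))

end Polynomials

/-! ### The parametrisation by logarithms of zeros and poles -/

variable {nz np : ℕ}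

/-- The sign `-1` for zeros and `1` for poles. -/
def sgn : Fin nz ⊕ Fin np → ℂ := Sum.elim (fun _ => -1) fun _ => 1

theorem sgn_ne_zero (k : Fin nz ⊕ Fin np) : sgn k ≠ 0 := by
  rcases k with i | j <;> simp [sgn]

theorem add_sum_sgn_ne_zero {r : ℕ} (hn : np + r < nz) :
    (r : ℂ) + ∑ k : Fin nz ⊕ Fin np, sgn k ≠ 0 := by
  simp only [sgn, Fintype.sum_sum_type, Sum.elim_inl, Sum.elim_inr, Finset.sum_const,
    Finset.card_univ, Fintype.card_fin, nsmul_eq_mul, mul_neg, mul_one]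
  intro h
  have : ((np + r : ℕ) : ℂ) = nz := by push_cast; linear_combination h
  exact hn.ne (Nat.cast_injective this)

/-- The point of the coefficient space with given logarithms of zeros and poles. -/
def ofLogs (x : Space nz np) : Space nz np :=
  Sum.elim (fun i => (∏ i, (X - C (Complex.exp (x (Sum.inl i))))).coeff (i : ℕ))
    fun j => (∏ j, (X - C (Complex.exp (x (Sum.inr j))))).coeff (j : ℕ)

theorem contDiff_ofLogs : ContDiff ℂ 1 (ofLogs (nz := nz) (np := np)) := by
  refine contDiff_pi.2 fun k => ?_
  rcases k with i | j
  · exact contDiff_coeff_prod_X_sub_C (s := Finset.univ)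
      (f := fun i (x : Space nz np) => Complex.exp (x (Sum.inl i))) (fun i _ => by fun_prop) _
  · exact contDiff_coeff_prod_X_sub_C (s := Finset.univ)
      (f := fun j (x : Space nz np) => Complex.exp (x (Sum.inr j))) (fun j _ => by fun_prop) _

theorem hasFDerivAt_ofLogs (x : Space nz np) : HasFDerivAt ofLogs (fderiv ℂ ofLogs x) x :=
  (contDiff_ofLogs.differentiable one_ne_zero x).hasFDerivAt

theorem numer_ofLogs (x : Space nz np) :
    numer (ofLogs x) = ∏ i, (X - C (Complex.exp (x (Sum.inl i)))) :=
  eq_X_pow_add_sum_of_monic (p := ∏ i, (X - C (Complex.exp (x (Sum.inl i)))))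
    (monic_prod_X_sub_C _ _) (by rw [natDegree_finsetProd_X_sub_C_eq_card]; simp)

theorem denom_ofLogs (x : Space nz np) :
    denom (ofLogs x) = ∏ j, (X - C (Complex.exp (x (Sum.inr j)))) :=
  eq_X_pow_add_sum_of_monic (p := ∏ j, (X - C (Complex.exp (x (Sum.inr j)))))
    (monic_prod_X_sub_C _ _) (by rw [natDegree_finsetProd_X_sub_C_eq_card]; simp)

theorem eq_of_numer_eq_of_denom_eq {c c' : Space nz np} (hn : numer c = numer c')
    (hd : denom c = denom c') : c = c' := by
  ext k
  rcases k with i | j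
  · have := congrArg (coeff · (i : ℕ)) hn
    simpa only [numer, coeff_X_pow_add_sum] using this
  · have := congrArg (coeff · (j : ℕ)) hd
    simpa only [denom, coeff_X_pow_add_sum] using this

theorem superpotential_ofLogs (r : ℕ) (x : Space nz np) (w : ℂ) :
    superpotential r (ofLogs x) w = 1 / w ^ r * ((∏ i, (w - Complex.exp (x (Sum.inl i)))) /
      ∏ j, (w - Complex.exp (x (Sum.inr j)))) := by
  rw [superpotential, numer_ofLogs, denom_ofLogs, eval_prod, eval_prod]
  simp only [eval_sub, eval_X, eval_C]
  rw [div_mul_div_comm, one_mul]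

theorem isLogFactorisation_ofLogs (r : ℕ) (x : Space nz np) : IsLogFactorisation r (ofLogs x) x :=
  superpotential_ofLogs r x

/-- Clearing denominators off a finite set yields a polynomial identity. Coprimality then makes one
numerator divide the other; both are monic of the same degree, so they agree, and cancelling them
identifies the denominators. -/
theorem IsLogFactorisation.eq_ofLogs {r : ℕ} {c x : Space nz np} (h : IsLogFactorisation r c x)
    (hc : IsCoprime (numer c) (denom c)) : c = ofLogs x := by
  have hnm : (numer c).Monic := monic_X_pow_add_sum _
  have hdm : (denom c).Monic := monic_X_pow_add_sum _
  have hnm' : (numer (ofLogs x)).Monic := monic_X_pow_add_sum _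
  have hdm' : (denom (ofLogs x)).Monic := monic_X_pow_add_sum _
  have hmul : numer c * denom (ofLogs x) = numer (ofLogs x) * denom c := by
    refine eq_of_infinite_eval_eq _ _ ?_
    refine Set.Infinite.mono ?_ (Set.Finite.infinite_compl
      (X * (denom c * denom (ofLogs x))).roots.toFinset.finite_toSet)
    intro w hw
    have h0 : X * (denom c * denom (ofLogs x)) ≠ 0 :=
      mul_ne_zero X_ne_zero (mul_ne_zero hdm.ne_zero hdm'.ne_zero)
    simp only [Set.mem_compl_iff, Finset.mem_coe, Multiset.mem_toFinset, mem_roots h0, IsRoot.def,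
      eval_mul, eval_X, mul_eq_zero, not_or] at hw
    obtain ⟨hw0, hw1, hw2⟩ := hw
    have h1 := (h w).trans (isLogFactorisation_ofLogs r x w).symm
    rw [superpotential, superpotential] at h1
    have hwr := pow_ne_zero r hw0
    field_simp at h1
    rw [Set.mem_ofPred_eq, eval_mul, eval_mul, h1, mul_comm]
  have hn : numer c = numer (ofLogs x) := by
    refine (eq_of_monic_of_dvd_of_natDegree_le hnm hnm' ?_ ?_).symm
    · exact hc.dvd_of_dvd_mul_right (Dvd.intro _ hmul)
    · rw [numer, numer, natDegree_X_pow_add_sum, natDegree_X_pow_add_sum]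
  refine eq_of_numer_eq_of_denom_eq hn ?_
  rw [hn] at hmul
  exact (mul_left_cancel₀ hnm'.ne_zero hmul).symm

/-- Exponentials never vanish, so the conditions at `0` are automatic. Simple zeros, simple poles
and coprimality together say that all the exponentials are distinct. -/
theorem ofLogs_mem_distinctZeros_iff {x : Space nz np} :
    ofLogs x ∈ distinctZeros nz np ↔ Function.Injective fun k => Complex.exp (x k) := by
  simp only [distinctZeros, hurwitzSpace, Set.mem_ofPred_eq, numer_ofLogs, denom_ofLogs,
    nodup_roots_prod_X_sub_C_iff]
  constructor
  · rintro ⟨⟨-, -, hd, a, b, hab⟩, hn⟩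
    have hne : ∀ i j, Complex.exp (x (Sum.inl i)) ≠ Complex.exp (x (Sum.inr j)) := fun i j h => by
      have := congrArg (eval (Complex.exp (x (Sum.inl i)))) hab
      simp only [eval_add, eval_mul, eval_prod, eval_sub, eval_X, eval_C, eval_one] at this
      rw [Finset.prod_eq_zero (Finset.mem_univ i) (sub_self _),
        Finset.prod_eq_zero (Finset.mem_univ j) (sub_eq_zero.2 h)] at this
      simp at this
    rintro (i | j) (i' | j') h
    · exact congrArg _ (hn h)
    · exact absurd h (hne i j')
    · exact absurd h.symm (hne i' j)
    · exact congrArg _ (hd h)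
  · intro h
    refine ⟨⟨?_, ?_, ?_, ?_⟩, ?_⟩
    · simp [eval_prod, Finset.prod_eq_zero_iff, Complex.exp_ne_zero]
    · simp [eval_prod, Finset.prod_eq_zero_iff, Complex.exp_ne_zero]
    · exact h.comp Sum.inr_injective
    · refine IsCoprime.prod_left fun i _ => IsCoprime.prod_right fun j _ => ?_
      exact isCoprime_X_sub_C_of_isUnit_sub
        (sub_ne_zero.2 fun h' => Sum.inl_ne_inr (h h')).isUnit
    · exact h.comp Sum.inl_injective

theorem exists_eq_ofLogs {c : Space nz np} (hc : c ∈ distinctZeros nz np) :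
    ∃ x, c = ofLogs x := by
  obtain ⟨x, hx⟩ := exists_prod_X_sub_C_exp (monic_X_pow_add_sum _) (natDegree_X_pow_add_sum _)
    hc.1.1
  obtain ⟨y, hy⟩ := exists_prod_X_sub_C_exp (monic_X_pow_add_sum _) (natDegree_X_pow_add_sum _)
    hc.1.2.1
  refine ⟨Sum.elim x y, eq_of_numer_eq_of_denom_eq ?_ ?_⟩
  · rw [numer_ofLogs]; exact hx
  · rw [denom_ofLogs]; exact hy

/-! ### Logarithmic derivatives of the superpotential -/

/-- Serves for both derivatives of `log λ`: in `w`, and along a line of parameters with `w` fixed.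
-/
theorem logDeriv_mul_prod_div_prod {u : ℂ → ℂ} {f : Fin nz ⊕ Fin np → ℂ → ℂ} {t : ℂ}
    (hu : u t ≠ 0) (hud : DifferentiableAt ℂ u t) (hf : ∀ k, f k t ≠ 0)
    (hfd : ∀ k, DifferentiableAt ℂ (f k) t) :
    logDeriv (fun t => u t * ((∏ i, f (Sum.inl i) t) / ∏ j, f (Sum.inr j) t)) t =
      logDeriv u t - ∑ k, sgn k * logDeriv (f k) t := by
  have h1 : ∏ i, f (Sum.inl i) t ≠ 0 := Finset.prod_ne_zero_iff.2 fun i _ => hf _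
  have h2 : ∏ j, f (Sum.inr j) t ≠ 0 := Finset.prod_ne_zero_iff.2 fun i _ => hf _
  have d1 : DifferentiableAt ℂ (fun t => ∏ i, f (Sum.inl i) t) t :=
    DifferentiableAt.fun_finsetProd fun i _ => hfd _
  have d2 : DifferentiableAt ℂ (fun t => ∏ j, f (Sum.inr j) t) t :=
    DifferentiableAt.fun_finsetProd fun i _ => hfd _
  rw [logDeriv_mul (g := fun t => (∏ i, f (Sum.inl i) t) / ∏ j, f (Sum.inr j) t) t hu
      (div_ne_zero h1 h2) hud (d1.fun_div d2 h2),
    logDeriv_div (f := fun t => ∏ i, f (Sum.inl i) t) t h1 h2 d1 d2,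
    logDeriv_prod (fun i _ => hf _) (fun i _ => hfd _),
    logDeriv_prod (fun i _ => hf _) (fun i _ => hfd _), Fintype.sum_sum_type]
  simp only [sgn, Sum.elim_inl, Sum.elim_inr, neg_one_mul, one_mul, Finset.sum_neg_distrib]
  ring

theorem logDeriv_superpotential_ofLogs (r : ℕ) {x : Space nz np} {w : ℂ} (h0 : w ≠ 0)
    (hw : ∀ k, w ≠ Complex.exp (x k)) :
    logDeriv (superpotential r (ofLogs x)) w =
      -(∑ k, sgn k / (w - Complex.exp (x k))) - r / w := by
  rw [funext (superpotential_ofLogs r x), logDeriv_mul_prod_div_prod (u := fun w => 1 / w ^ r)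
    (f := fun k w => w - Complex.exp (x k)) (one_div_ne_zero (pow_ne_zero r h0))
    ((differentiableAt_const _).fun_div (by fun_prop) (pow_ne_zero r h0))
    (fun k => sub_ne_zero.2 (hw k)) (fun k => by fun_prop)]
  have h1 : logDeriv (fun w : ℂ => 1 / w ^ r) w = -(r / w) := by
    rw [logDeriv_div (f := fun _ => (1 : ℂ)) (g := fun w => w ^ r) w one_ne_zero
      (pow_ne_zero r h0) (by fun_prop) (by fun_prop), logDeriv_const, logDeriv_pow,
      Pi.zero_apply, zero_sub]
  rw [h1]
  have h2 : ∀ k, logDeriv (fun w => w - Complex.exp (x k)) w = 1 / (w - Complex.exp (x k)) :=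
    fun k => by rw [logDeriv_apply]; simp
  simp only [h2, mul_one_div]
  ring

/-- By the chain rule along `x + t • ξ` this is a one-variable logarithmic derivative, in which the
factor `w ^ (-r)` is constant. -/
theorem dirLogDeriv_ofLogs (r : ℕ) {x : Space nz np} (ξ : Space nz np) {w : ℂ} (h0 : w ≠ 0)
    (hw : ∀ k, w ≠ Complex.exp (x k)) :
    dirLogDeriv r (ofLogs x) (fderiv ℂ ofLogs x ξ) w =
      ∑ k, sgn k * ξ k * Complex.exp (x k) / (w - Complex.exp (x k)) := by
  have hden : (denom (ofLogs x)).eval w ≠ 0 := by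
    rw [denom_ofLogs, eval_prod, Finset.prod_ne_zero_iff]
    intro j _
    simpa [sub_eq_zero] using hw (Sum.inr j)
  have hdiff : DifferentiableAt ℂ (fun c : Space nz np => superpotential r c w) (ofLogs x) := by
    have hN : Differentiable ℂ fun c : Space nz np => (numer c).eval w := by
      simp only [numer, eval_add, eval_pow, eval_X, eval_finsetSum, eval_mul, eval_C]
      fun_prop
    have hD : Differentiable ℂ fun c : Space nz np => (denom c).eval w := by
      simp only [denom, eval_add, eval_pow, eval_X, eval_finsetSum, eval_mul, eval_C]
      fun_prop
    simp only [superpotential, div_eq_mul_inv]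
    exact (hN _).fun_mul (((hD _).const_mul (w ^ r)).fun_inv
      (mul_ne_zero (pow_ne_zero r h0) hden))
  have hline : HasDerivAt (fun t : ℂ => x + t • ξ) ξ 0 := by
    simpa using ((hasDerivAt_id (0 : ℂ)).smul_const ξ).const_add x
  have hx0 : x + (0 : ℂ) • ξ = x := by simp
  have h1 : HasDerivAt (fun t : ℂ => ofLogs (x + t • ξ)) (fderiv ℂ ofLogs x ξ) 0 := by
    refine HasFDerivAt.comp_hasDerivAt (f := fun t : ℂ => x + t • ξ) (l := ofLogs) 0 ?_ hline
    rw [hx0]; exact hasFDerivAt_ofLogs x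
  have h2 : HasDerivAt (fun t : ℂ => superpotential r (ofLogs (x + t • ξ)) w)
      (fderiv ℂ (fun c : Space nz np => superpotential r c w) (ofLogs x)
        (fderiv ℂ ofLogs x ξ)) 0 := by
    refine HasFDerivAt.comp_hasDerivAt (f := fun t : ℂ => ofLogs (x + t • ξ))
      (l := fun c : Space nz np => superpotential r c w) 0 ?_ h1
    rw [hx0]; exact hdiff.hasFDerivAt
  have h3 : dirLogDeriv r (ofLogs x) (fderiv ℂ ofLogs x ξ) w =
      logDeriv (fun t : ℂ => superpotential r (ofLogs (x + t • ξ)) w) 0 := by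
    rw [dirLogDeriv, logDeriv_apply, h2.deriv, hx0]
  rw [h3]
  simp only [superpotential_ofLogs]
  rw [logDeriv_mul_prod_div_prod (u := fun _ => 1 / w ^ r)
    (f := fun k t => w - Complex.exp ((x + t • ξ) k)) (one_div_ne_zero (pow_ne_zero r h0)) (by fun_prop)
    (fun k => by rw [hx0]; exact sub_ne_zero.2 (hw k))
    (fun k => by simp only [Pi.add_apply, Pi.smul_apply, smul_eq_mul]; fun_prop),
    logDeriv_const, Pi.zero_apply, zero_sub, ← Finset.sum_neg_distrib]
  refine Finset.sum_congr rfl fun k _ => ?_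
  have h4 : HasDerivAt (fun t : ℂ => w - Complex.exp ((x + t • ξ) k))
      (-(Complex.exp ((x + (0 : ℂ) • ξ) k) * ξ k)) 0 :=
    ((hasDerivAt_pi.1 hline k).cexp).const_sub w
  rw [logDeriv_apply, h4.deriv, hx0]
  ring

/-- A kernel vector `ξ` leaves `λ` unchanged to first order, so `∑ s_k ξ_k ζ_k / (w - ζ_k)` vanishes
identically; its numerator at the distinct nodes gives `ξ = 0`. -/
theorem fderiv_ofLogs_injective {x : Space nz np}
    (hx : Function.Injective fun k => Complex.exp (x k)) :
    Function.Injective (fderiv ℂ ofLogs x) := by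
  rw [injective_iff_map_eq_zero]
  intro ξ hξ
  have hzero : fieldNumer sgn (fun k => Complex.exp (x k)) ξ = 0 := by
    refine eq_of_infinite_eval_eq _ _ (Set.Infinite.mono ?_ (Set.Finite.infinite_compl
      ((Set.finite_range fun k => Complex.exp (x k)).insert 0)))
    intro w hw
    simp only [Set.mem_compl_iff, Set.mem_insert_iff, Set.mem_range, not_or, not_exists] at hw
    have hwk : ∀ k, w ≠ Complex.exp (x k) := fun k => Ne.symm (hw.2 k)
    -- `ofLogs` does not involve `r`, so `r = 0` may be used.
    have h := dirLogDeriv_ofLogs 0 ξ hw.1 hwk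
    rw [hξ, dirLogDeriv, map_zero, zero_div] at h
    rw [Set.mem_ofPred_eq, eval_fieldNumer hwk, ← h, zero_mul, eval_zero]
  ext k
  have h := eval_fieldNumer_node sgn (fun k => Complex.exp (x k)) ξ k
  rw [hzero, eval_zero, eq_comm, mul_eq_zero, mul_eq_zero, mul_eq_zero] at h
  have h1 := eval_nodal_erase_ne_zero hx k
  have h2 := Complex.exp_ne_zero (x k)
  have h3 := sgn_ne_zero k
  tauto

/-- The differential of `ofLogs`, as an isomorphism, where zeros and poles are distinct. -/
def fderivOfLogsEquiv {x : Space nz np} (hx : Function.Injective fun k => Complex.exp (x k)) :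
    Space nz np ≃L[ℂ] Space nz np :=
  (LinearEquiv.ofInjectiveEndo (fderiv ℂ ofLogs x : Space nz np →ₗ[ℂ] Space nz np)
    (fderiv_ofLogs_injective hx)).toContinuousLinearEquiv

theorem coe_fderivOfLogsEquiv {x : Space nz np}
    (hx : Function.Injective fun k => Complex.exp (x k)) :
    (fderivOfLogsEquiv hx : Space nz np →L[ℂ] Space nz np) = fderiv ℂ ofLogs x := by
  ext1 ξ; rfl

/-! ### Critical points and the intersection form -/

/-- `criticalPoints` excludes only poles, so zeros of `λ`, where `log λ` is singular, must be ruled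
out separately: they are simple. -/
theorem deriv_superpotential_ofLogs_zero_ne_zero (r : ℕ) {x : Space nz np}
    (hx : Function.Injective fun k => Complex.exp (x k)) (i : Fin nz) :
    deriv (superpotential r (ofLogs x)) (Complex.exp (x (Sum.inl i))) ≠ 0 := by
  set z := Complex.exp (x (Sum.inl i)) with hz
  set g : ℂ → ℂ := fun w => 1 / w ^ r *
    ((∏ l ∈ Finset.univ.erase i, (w - Complex.exp (x (Sum.inl l)))) /
      ∏ j, (w - Complex.exp (x (Sum.inr j)))) with hg
  have hsp : superpotential r (ofLogs x) = fun w => (w - z) * g w := by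
    ext w
    rw [superpotential_ofLogs, ← Finset.mul_prod_erase _ _ (Finset.mem_univ i)]
    ring
  have hz0 : z ^ r ≠ 0 := pow_ne_zero r (Complex.exp_ne_zero _)
  have hd : ∏ j, (z - Complex.exp (x (Sum.inr j))) ≠ 0 :=
    Finset.prod_ne_zero_iff.2 fun j _ => sub_ne_zero.2 fun h => Sum.inl_ne_inr (hx h)
  have hn : ∏ l ∈ Finset.univ.erase i, (z - Complex.exp (x (Sum.inl l))) ≠ 0 :=
    Finset.prod_ne_zero_iff.2 fun l hl => sub_ne_zero.2 fun h =>
      Finset.ne_of_mem_erase hl (Sum.inl_injective (hx h.symm))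
  have hgd : DifferentiableAt ℂ g z := by
    have h1 : DifferentiableAt ℂ (fun w : ℂ => 1 / w ^ r) z :=
      (differentiableAt_const _).fun_div (differentiableAt_id.pow r) hz0
    exact h1.mul (DifferentiableAt.fun_div (by fun_prop) (by fun_prop) hd)
  have h : HasDerivAt (fun w => (w - z) * g w) (1 * g z + (z - z) * deriv g z) z :=
    ((hasDerivAt_id z).sub_const z).mul hgd.hasDerivAt
  rw [hsp, h.deriv, sub_self, zero_mul, add_zero, one_mul]
  exact mul_ne_zero (one_div_ne_zero hz0) (div_ne_zero hn hd)

/-- Off `0` and the nodes, `λ' / λ = P / (w Q)` with `λ` and `w Q` non-zero. At `0` and at the nodes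
neither side holds. -/
theorem criticalPoints_ofLogs {r : ℕ} (hr : 0 < r) (hn : np + r < nz) {x : Space nz np}
    (hx : Function.Injective fun k => Complex.exp (x k)) :
    criticalPoints r (ofLogs x) =
      ((critPoly (r : ℂ) sgn fun k => Complex.exp (x k)).roots.toFinset : Set ℂ) := by
  have hr0 : (r : ℂ) ≠ 0 := Nat.cast_ne_zero.2 hr.ne'
  ext w
  rw [Finset.mem_coe, Multiset.mem_toFinset, mem_roots (critPoly_ne_zero (add_sum_sgn_ne_zero hn)),
    IsRoot.def]
  by_cases h0 : w = 0
  · subst h0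
    refine iff_of_false (fun h => h.1 rfl) ?_
    rw [eval_critPoly_zero]
    exact neg_ne_zero.2 (mul_ne_zero hr0
      (Lagrange.eval_nodal_not_at_node fun k _ => (Complex.exp_ne_zero _).symm))
  by_cases hk : ∃ k, w = Complex.exp (x k)
  · obtain ⟨k, rfl⟩ := hk
    refine iff_of_false ?_ ?_
    · rintro ⟨-, h1, h2⟩
      rcases k with i | j
      · exact deriv_superpotential_ofLogs_zero_ne_zero r hx i h2
      · refine h1 ?_
        rw [denom_ofLogs, eval_prod]
        exact Finset.prod_eq_zero (Finset.mem_univ j) (by simp)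
    · rw [eval_critPoly_node (r : ℂ) sgn (fun k => Complex.exp (x k)) k]
      exact neg_ne_zero.2 (mul_ne_zero (mul_ne_zero (sgn_ne_zero k) (Complex.exp_ne_zero _))
        (eval_nodal_erase_ne_zero hx k))
  · have hw : ∀ k, w ≠ Complex.exp (x k) := not_exists.1 hk
    have hden : (denom (ofLogs x)).eval w ≠ 0 := by
      rw [denom_ofLogs, eval_prod, Finset.prod_ne_zero_iff]
      intro j _
      simpa [sub_eq_zero] using hw (Sum.inr j)
    have hsp : superpotential r (ofLogs x) w ≠ 0 := by
      rw [superpotential_ofLogs]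
      exact mul_ne_zero (one_div_ne_zero (pow_ne_zero r h0))
        (div_ne_zero (Finset.prod_ne_zero_iff.2 fun i _ => sub_ne_zero.2 (hw _))
          (Finset.prod_ne_zero_iff.2 fun i _ => sub_ne_zero.2 (hw _)))
    have hQ : w * (Lagrange.nodal Finset.univ fun k => Complex.exp (x k)).eval w ≠ 0 :=
      mul_ne_zero h0 (Lagrange.eval_nodal_not_at_node fun k _ => hw k)
    rw [eval_critPoly h0 hw, ← logDeriv_superpotential_ofLogs r h0 hw, logDeriv_apply,
      mul_eq_zero, or_iff_left hQ, div_eq_zero_iff, or_iff_left hsp]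
    exact ⟨fun h => h.2.2, fun h => ⟨h0, hden, h⟩⟩

/-- The intersection form in logarithmic coordinates. -/
theorem intersectionForm_ofLogs {r : ℕ} (hr : 0 < r) (hn : np + r < nz) {x : Space nz np}
    (hx : Function.Injective fun k => Complex.exp (x k)) (ξ η : Space nz np) :
    intersectionForm r (ofLogs x) (fderiv ℂ ofLogs x ξ) (fderiv ℂ ofLogs x η) =
      Matrix.toBilin' (formMatrix (r : ℂ) sgn) ξ η := by
  rw [formMatrix_toBilin'_apply, ← sum_residue_critPoly (Nat.cast_ne_zero.2 hr.ne') sgn_ne_zero hx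
    (fun k => Complex.exp_ne_zero _) (add_sum_sgn_ne_zero hn), intersectionForm,
    criticalPoints_ofLogs hr hn hx, finsum_mem_coe_finset]
  refine Finset.sum_congr rfl fun a _ => residue_congr ?_
  have hfin : ∀ᶠ w in 𝓝[≠] a, w ∉ insert 0 (Set.range fun k => Complex.exp (x k)) :=
    nhdsNE_le_cofinite a ((Set.finite_range _).insert 0).compl_mem_cofinite
  filter_upwards [hfin] with w hw
  simp only [Set.mem_insert_iff, Set.mem_range, not_or, not_exists] at hw
  obtain ⟨h0, hw⟩ := hw
  have hw : ∀ k, w ≠ Complex.exp (x k) := fun k => Ne.symm (hw k)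
  have hQ : (Lagrange.nodal Finset.univ fun k => Complex.exp (x k)).eval w ≠ 0 :=
    Lagrange.eval_nodal_not_at_node fun k _ => hw k
  rw [dirLogDeriv_ofLogs r ξ h0 hw, dirLogDeriv_ofLogs r η h0 hw,
    logDeriv_superpotential_ofLogs r h0 hw, eval_mul, eval_mul, eval_mul, eval_X,
    eval_fieldNumer hw, eval_fieldNumer hw, eval_critPoly h0 hw, primaryDensity]
  generalize -(∑ k, sgn k / (w - Complex.exp (x k))) - (r : ℂ) / w = ℓ
  -- Where `ℓ = 0`, both quotients are `0` by the convention for division by zero.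
  obtain rfl | hℓ := eq_or_ne ℓ 0
  · simp
  · field_simp

/-! ### Logarithmic charts -/

theorem isOpen_setOf_injective_exp :
    IsOpen {x : Space nz np | Function.Injective fun k => Complex.exp (x k)} := by
  have : {x : Space nz np | Function.Injective fun k => Complex.exp (x k)} =
      ⋂ k, ⋂ l, ⋂ (_ : k ≠ l), {x | Complex.exp (x k) ≠ Complex.exp (x l)} := by
    ext x
    simp only [Set.mem_ofPred_eq, Set.mem_iInter]
    exact ⟨fun h k l hkl hkl' => hkl (h hkl'), fun h k l hkl => by_contra fun h' => h k l h' hkl⟩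
  rw [this]
  refine isOpen_iInter_of_finite fun k => isOpen_iInter_of_finite fun l =>
    isOpen_iInter_of_finite fun _ => isOpen_ne_fun ?_ ?_ <;> fun_prop

theorem exists_isLogChart (r : ℕ) {x : Space nz np}
    (hx : Function.Injective fun k => Complex.exp (x k)) :
    ∃ e : OpenPartialHomeomorph (Space nz np) (Space nz np),
      IsLogChart r e ∧ ofLogs x ∈ e.source ∧ e (ofLogs x) = x := by
  have hf' : HasFDerivAt ofLogs (fderivOfLogsEquiv hx : Space nz np →L[ℂ] Space nz np) x := by
    rw [coe_fderivOfLogsEquiv]; exact hasFDerivAt_ofLogs x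
  -- Inverse function theorem at `x`, restricted to distinct exponentials so that the derivative is
  -- invertible throughout and the image lies in `distinctZeros`. The chart is `F.symm`.
  set F := (contDiff_ofLogs.contDiffAt.toOpenPartialHomeomorph ofLogs hf' one_ne_zero).restrOpen
    _ (isOpen_setOf_injective_exp (nz := nz) (np := np)) with hF
  have hcoe : ∀ y, F y = ofLogs y := fun y => rfl
  have hsrc : ∀ y ∈ F.source, Function.Injective fun k => Complex.exp (y k) := fun y hy => hy.2
  have hxF : x ∈ F.source :=
    ⟨contDiff_ofLogs.contDiffAt.mem_toOpenPartialHomeomorph_source hf' one_ne_zero, hx⟩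
  have hsymm : ∀ c ∈ F.target, ofLogs (F.symm c) = c := fun c hc => F.right_inv hc
  refine ⟨F.symm, ⟨?_, ?_, ?_, ?_⟩, ?_, ?_⟩
  · intro c hc
    rw [← hsymm c hc]
    exact ofLogs_mem_distinctZeros_iff.2 (hsrc _ (F.map_target hc))
  · intro c hc
    refine DifferentiableAt.differentiableWithinAt (HasFDerivAt.differentiableAt
      (F.hasFDerivAt_symm (f' := fderivOfLogsEquiv (hsrc _ (F.map_target hc))) hc ?_))
    rw [coe_fderivOfLogsEquiv]
    exact hasFDerivAt_ofLogs _
  · exact (contDiff_ofLogs.differentiable one_ne_zero).differentiableOn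
  · intro c hc
    have := isLogFactorisation_ofLogs r (F.symm c)
    rwa [hsymm c hc] at this
  · exact F.map_source hxF
  · exact F.left_inv hxF

theorem IsLogChart.eq_ofLogs {r : ℕ} {e : OpenPartialHomeomorph (Space nz np) (Space nz np)}
    (he : IsLogChart r e) {c : Space nz np} (hc : c ∈ e.source) : c = ofLogs (e c) :=
  (he.factorises c hc).eq_ofLogs (he.source_subset hc).1.2.2.2

/-- The inverse of any logarithmic chart agrees near `e c` with `ofLogs`, so coordinate fields
depend on the chart only through the point `e c`. -/
theorem IsLogChart.coordField_eq {r : ℕ}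
    {e : OpenPartialHomeomorph (Space nz np) (Space nz np)} (he : IsLogChart r e) {c : Space nz np}
    (hc : c ∈ e.source) (k : Fin nz ⊕ Fin np) :
    coordField e k c = fderiv ℂ ofLogs (e c) (Pi.single k 1) := by
  have h : e.symm =ᶠ[𝓝 (e c)] ofLogs := by
    filter_upwards [e.open_target.mem_nhds (e.map_source hc)] with y hy
    rw [he.eq_ofLogs (e.map_target hy), e.right_inv hy]
  rw [coordField, h.fderiv_eq]

end TrigHurwitz

end

/-! ### The theorem -/

theorem mainTheorem3 (nz np r : ℕ) (hr : 0 < r) (hn : np + r < nz) :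
    -- where the zeros are distinct, the intersection form is a holomorphic metric
    (∀ c ∈ TrigHurwitz.distinctZeros nz np,
      ∃ B : LinearMap.BilinForm ℂ (TrigHurwitz.Space nz np),
        B.IsSymm ∧ B.Nondegenerate ∧
          ∀ V W, B V W = TrigHurwitz.intersectionForm r c V W) ∧
    -- logarithms of zeros and poles exist at every point
    (∀ c ∈ TrigHurwitz.distinctZeros nz np, ∃ x, TrigHurwitz.IsLogFactorisation r c x) ∧
    -- every choice of them extends to a local holomorphic coordinate system
    (∀ c ∈ TrigHurwitz.distinctZeros nz np, ∀ x, TrigHurwitz.IsLogFactorisation r c x →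
      ∃ e : OpenPartialHomeomorph (TrigHurwitz.Space nz np) (TrigHurwitz.Space nz np),
        TrigHurwitz.IsLogChart r e ∧ c ∈ e.source ∧ e c = x) ∧
    -- in all these coordinate systems the matrix of the intersection form is constant
    ∃ G : Matrix (Fin nz ⊕ Fin np) (Fin nz ⊕ Fin np) ℂ, G.IsSymm ∧ G.det ≠ 0 ∧
      ∀ e : OpenPartialHomeomorph (TrigHurwitz.Space nz np) (TrigHurwitz.Space nz np),
        TrigHurwitz.IsLogChart r e → ∀ c ∈ e.source, ∀ k l,
          TrigHurwitz.intersectionForm r c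
            (TrigHurwitz.coordField e k c) (TrigHurwitz.coordField e l c) = G k l := by
  have hsymm := TrigHurwitz.formMatrix_isSymm (r : ℂ) (TrigHurwitz.sgn (nz := nz) (np := np))
  have hdet := TrigHurwitz.formMatrix_det_ne_zero (Nat.cast_ne_zero.2 hr.ne')
    TrigHurwitz.sgn_ne_zero (TrigHurwitz.add_sum_sgn_ne_zero hn)
  refine ⟨fun c hc => ?_, fun c hc => ?_, fun c hc x hx => ?_,
    TrigHurwitz.formMatrix (r : ℂ) TrigHurwitz.sgn, hsymm, hdet, fun e he c hc k l => ?_⟩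
  · obtain ⟨x, rfl⟩ := TrigHurwitz.exists_eq_ofLogs hc
    have hx := TrigHurwitz.ofLogs_mem_distinctZeros_iff.1 hc
    -- The form on the tangent space at `c` is the constant one transported by the derivative of
    -- `ofLogs`.
    have hB : ∀ V W, LinearMap.BilinForm.congr
        (TrigHurwitz.fderivOfLogsEquiv hx).toLinearEquiv (Matrix.toBilin'
          (TrigHurwitz.formMatrix (r : ℂ) TrigHurwitz.sgn)) V W =
        TrigHurwitz.intersectionForm r (TrigHurwitz.ofLogs x) V W := fun V W => by
      obtain ⟨ξ, rfl⟩ := (TrigHurwitz.fderivOfLogsEquiv hx).surjective V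
      obtain ⟨η, rfl⟩ := (TrigHurwitz.fderivOfLogsEquiv hx).surjective W
      rw [LinearMap.BilinForm.congr_apply]
      refine Eq.trans ?_ (TrigHurwitz.intersectionForm_ofLogs hr hn hx ξ η).symm
      congr 1
      · congr 1
        exact (TrigHurwitz.fderivOfLogsEquiv hx).symm_apply_apply ξ
      · exact (TrigHurwitz.fderivOfLogsEquiv hx).symm_apply_apply η
    refine ⟨_, ⟨fun V W => ?_⟩, LinearMap.BilinForm.Nondegenerate.congr _
      (LinearMap.BilinForm.nondegenerate_toBilin'_of_det_ne_zero' _ hdet), hB⟩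
    rw [LinearMap.BilinForm.congr_apply, LinearMap.BilinForm.congr_apply]
    exact (Matrix.isSymm_toBilin'_iff_isSymm.2 hsymm).eq _ _
  · obtain ⟨x, rfl⟩ := TrigHurwitz.exists_eq_ofLogs hc
    exact ⟨x, TrigHurwitz.isLogFactorisation_ofLogs r x⟩
  · obtain rfl := hx.eq_ofLogs hc.1.2.2.2
    exact TrigHurwitz.exists_isLogChart r (TrigHurwitz.ofLogs_mem_distinctZeros_iff.1 hc)
  · have hce := he.eq_ofLogs hc
    have hmem := he.source_subset hc
    rw [he.coordField_eq hc, he.coordField_eq hc]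
    -- With `e c` generalised, `c` occurs on one side of `hce` only and can be eliminated.
    generalize e c = x at hce ⊢
    subst hce
    rw [TrigHurwitz.intersectionForm_ofLogs hr hn
      (TrigHurwitz.ofLogs_mem_distinctZeros_iff.1 hmem), Matrix.toBilin'_single]
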